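/- For $n\ge 1$ let $x_j=\cos(j\pi/n)$, $j=0,\dots,n$, be the Chebyshev points, let $w_k=1/\prod_{j\ne k}(x_k-x_j)$ be the Lagrange weights, and let $S_r$ denote the elementary symmetric function of order $r$. For a unit roundoff $u>0$ put $\gamma_N=Nu/(1-Nu)$ (defined for $Nu<1$), and for a real function $f$ put $|f|=\max_{0\le j\le n}|f(x_j)|$. For $1\le m\le 4$ and $n\ge m$ consider, at the edge point $\zeta=x_0=1$, the rounding error bound for the $m$-th derivative $$U_{\mathcal R}=\gamma_{6n+4-m}\,|f|\sum_{k=0}^{n} m!\,|w_k|\,S_{n-m}\bigl(\{|x_j-\zeta| : 0\le j\le n,\ j\ne k\}\bigr).$$ Define $$C_1=\frac13+\sum_{k=1}^{\infty}\frac{4}{\pi^2k^2},\qquad C_2=\frac1{30}+\sum_{k=1}^{\infty}\frac{4}{\pi^2k^2}\Bigl(\frac13-\frac{2}{\pi^2k^2}\Bigr),$$ $$C_3=\frac1{630}+\sum_{k=1}^{\infty}\frac{2}{15\pi^6k^6}\bigl|\pi^4k^4-20\pi^2k^2+120\bigr|,$$ $$C_4=\frac1{22680}+\sum_{k=1}^{\infty}\frac{2}{315\pi^8k^8}\bigl|\pi^6k^6-42\pi^4k^4+840\pi^2k^2-5040\bigr|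 .$$ These series converge, with $C_1=1$, $C_2=\frac16$, $C_3=\frac1{90}$, $C_4=\frac1{2520}$. For each $m=1,2,3,4$, as $n\to\infty$, $$U_{\mathcal R}\sim\gamma_{6n+4-m}\,|f|\,m!\,C_m\,n^{2m},$$ and the same holds with the infinite series in $C_m$ replaced by its partial sum over $1\le k\le n$. Here $u=u_n>0$ and $f=f_n$ may vary with $n$ in any way, subject to $(6n+4-m)u_n<1$ for all large $n$; $a_n\sim b_n$ means $a_n-b_n=o(b_n)$. -/

import Mathlib

open Filter Asymptotics

namespace ChebRounding

noncomputable section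

/-- `γ_N = N u / (1 - N u)`, meaningful for `N u < 1`. -/
def gammaErr (u : ℝ) (N : ℕ) : ℝ := N * u / (1 - N * u)

/-- The Lagrange weight `w_k = 1 / ∏_{j ≠ k} (x_k - x_j)`. -/
def lagrangeWeight {n : ℕ} (x : Fin (n + 1) → ℝ) (k : Fin (n + 1)) : ℝ :=
  1 / ∏ j ∈ Finset.univ.erase k, (x k - x j)

/-- `|f| = max_j |f(x_j)|`. -/
def maxAbs {n : ℕ} (x : Fin (n + 1) → ℝ) (f : ℝ → ℝ) : ℝ :=
  Finset.univ.sup' Finset.univ_nonempty (fun j : Fin (n + 1) => |f (x j)|)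

/-- The rounding error bound `U_R` for the `m`-th derivative at `ζ` on the grid `x_0, …, x_n`
with unit roundoff `u`:
`γ_{6n-m+4} |f| ∑_k m! |w_k| S_{n-m}({|x_j - ζ| : j ≠ k})`,
where `S_r` is the elementary symmetric function of order `r`. -/
def roundingBound {n : ℕ} (x : Fin (n + 1) → ℝ) (ζ : ℝ) (m : ℕ) (u : ℝ) (f : ℝ → ℝ) : ℝ :=
  gammaErr u (6 * n + 4 - m) * maxAbs x f *
    ∑ k : Fin (n + 1), (m.factorial : ℝ) * |lagrangeWeight x k| *
      ((Finset.univ.erase k).val.map (fun j => |x j - ζ|)).esymm (n - m)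

/-- The Chebyshev points `x_j = cos (j π / n)`, `j = 0, …, n`. -/
def chebPoint (n : ℕ) (j : Fin (n + 1)) : ℝ := Real.cos ((j : ℕ) * Real.pi / n)

/-- The leading rational terms `1/3, 1/30, 1/630, 1/22680` for `m = 1, 2, 3, 4`. -/
def headTerm : ℕ → ℝ
  | 1 => 1 / 3
  | 2 => 1 / 30
  | 3 => 1 / 630
  | 4 => 1 / 22680
  | _ => 0

/-- The `k`-th term (`k ≥ 1`) of the series, for `m = 1, 2, 3, 4`. -/
def seriesTerm : ℕ → ℕ → ℝ
  | 1, k => 4 / (Real.pi ^ 2 * k ^ 2)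
  | 2, k => 4 / (Real.pi ^ 2 * k ^ 2) * (1 / 3 - 2 / (Real.pi ^ 2 * k ^ 2))
  | 3, k => 2 / (15 * Real.pi ^ 6 * k ^ 6) *
      |Real.pi ^ 4 * k ^ 4 - 20 * Real.pi ^ 2 * k ^ 2 + 120|
  | 4, k => 2 / (315 * Real.pi ^ 8 * k ^ 8) *
      |Real.pi ^ 6 * k ^ 6 - 42 * Real.pi ^ 4 * k ^ 4 + 840 * Real.pi ^ 2 * k ^ 2 - 5040|
  | _, _ => 0

end

end ChebRounding

namespace ChebRounding

open Polynomial Polynomial.Chebyshev Topology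

/-! ### The Lebesgue-type sum at the edge point as a derivative of `T_n` -/

/-! `T_n` takes the value `(-1)^k` at `x_k`, exactly the sign of `w_k`, so interpolating `T_n` on
the grid gives `T_n = ∑ |w_k| ∏_{j ≠ k} (X - x_j)`. Expanded about `1`, the right side has the
symmetric functions of `1 - x_j ≥ 0` as coefficients, so the sum in the bound equals `T_n^{(m)}(1) =
∏_{l<m} (n² - l²)/(2l+1)`, which is asymptotic to `n^{2m}/(2m-1)!!` (`sum_weight_mul_esymm_eq`). It
remains to see that `C_m = 1/(m! (2m-1)!!)`: the absolute values in the series can be dropped,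
leaving combinations of `ζ(2), ζ(4), ζ(6), ζ(8)` (`hasSum_seriesTerm`). -/

lemma chebPoint_eq_node (n : ℕ) (j : Fin (n + 1)) : chebPoint n j = node n j := rfl

lemma chebPoint_injective (n : ℕ) : Function.Injective (chebPoint n) := by
  intro i j hij
  rcases lt_trichotomy i j with h | h | h
  · exact absurd hij (node_lt (Nat.lt_succ_iff.mp j.2) (Fin.lt_def.mp h)).ne'
  · exact h
  · exact absurd hij (node_lt (Nat.lt_succ_iff.mp i.2) (Fin.lt_def.mp h)).ne

/-- The negative factors of `∏ (x_k - x_j)` are the `k` ones with `j < k`, as the nodes decrease. -/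
lemma abs_lagrangeWeight_chebPoint (n : ℕ) (k : Fin (n + 1)) :
    |lagrangeWeight (chebPoint n) k| = (-1) ^ (k : ℕ) * lagrangeWeight (chebPoint n) k := by
  have hmap : (Finset.univ.erase k).map Fin.valEmbedding = (Finset.range (n + 1)).erase k := by
    ext a
    simp only [Finset.mem_map, Finset.mem_erase, Finset.mem_univ, and_true, Finset.mem_range,
      Fin.valEmbedding_apply]
    constructor
    · rintro ⟨b, hb, rfl⟩
      exact ⟨fun h => hb (Fin.ext h), b.2⟩
    · rintro ⟨h1, h2⟩
      exact ⟨⟨a, h2⟩, fun h => h1 (congrArg Fin.val h), rfl⟩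
  have hpos := zero_lt_prod_node_sub_node (Nat.lt_succ_iff.mp k.2)
  rw [← hmap, Finset.prod_map] at hpos
  change 0 < (-1) ^ (k : ℕ) * ∏ j ∈ Finset.univ.erase k, (chebPoint n k - chebPoint n j) at hpos
  rw [lagrangeWeight]
  set p := ∏ j ∈ Finset.univ.erase k, (chebPoint n k - chebPoint n j)
  rcases neg_one_pow_eq_or ℝ (k : ℕ) with h | h
  · rw [h, one_mul] at hpos ⊢
    exact abs_of_pos (by positivity)
  · rw [h, neg_one_mul] at hpos ⊢
    exact abs_of_neg (by rw [one_div, inv_lt_zero]; linarith)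

lemma lagrangeBasis_eq_weight_mul {n : ℕ} (x : Fin (n + 1) → ℝ) (k : Fin (n + 1)) :
    Lagrange.basis Finset.univ x k =
      C (lagrangeWeight x k) * ∏ j ∈ Finset.univ.erase k, (X - C (x j)) := by
  simp only [Lagrange.basis, Lagrange.basisDivisor, Finset.prod_mul_distrib, lagrangeWeight,
    one_div, ← Finset.prod_inv_distrib, map_prod]

/-- No node exceeds `ζ`, so the shift turns `X - x_j` into `X + |x_j - ζ|`, and Vieta's formula
applies. -/
lemma coeff_taylor_prod_X_sub_C {n m : ℕ} (hm : m ≤ n) (x : Fin (n + 1) → ℝ) (ζ : ℝ)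
    (hx : ∀ j, x j ≤ ζ) (k : Fin (n + 1)) :
    (taylor ζ (∏ j ∈ Finset.univ.erase k, (X - C (x j)))).coeff m =
      ((Finset.univ.erase k).val.map (fun j => |x j - ζ|)).esymm (n - m) := by
  have hcard : (Finset.univ.erase k).card = n := by simp
  have htaylor : taylor ζ (∏ j ∈ Finset.univ.erase k, (X - C (x j))) =
      ∏ j ∈ Finset.univ.erase k, (X + C |x j - ζ|) := by
    change taylorAlgHom ζ _ = _
    rw [map_prod]
    refine Finset.prod_congr rfl fun j _ => ?_
    change taylor ζ _ = _
    rw [abs_of_nonpos (sub_nonpos.mpr (hx j)), map_sub, taylor_X, taylor_C]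
    simp only [map_neg, map_sub]
    ring
  rw [htaylor, Finset.prod_X_add_C_coeff _ _ (by rwa [hcard]), hcard, Finset.esymm_map_val]

/-- At the edge point `1`, the condition-number sum of the `m`-th derivative on the Chebyshev grid
is the `m`-th derivative of the Chebyshev polynomial `T_n`. -/
theorem sum_weight_mul_esymm_eq (n m : ℕ) (hm : m ≤ n) :
    ∑ k : Fin (n + 1), (m.factorial : ℝ) * |lagrangeWeight (chebPoint n) k| *
      ((Finset.univ.erase k).val.map (fun j => |chebPoint n j - 1|)).esymm (n - m) =
    (derivative^[m] (T ℝ n)).eval 1 := by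
  have hinterp : T ℝ n = ∑ k : Fin (n + 1),
      C ((-1) ^ (k : ℕ) * lagrangeWeight (chebPoint n) k) *
        ∏ j ∈ Finset.univ.erase k, (X - C (chebPoint n j)) := by
    rw [Lagrange.eq_interpolate (s := Finset.univ) (v := chebPoint n) (f := T ℝ n)
      (chebPoint_injective n).injOn
      (by rw [degree_T, Finset.card_univ, Fintype.card_fin]; exact_mod_cast Nat.lt_succ_self n),
      Lagrange.interpolate_apply]
    refine Finset.sum_congr rfl fun k _ => ?_
    rw [lagrangeBasis_eq_weight_mul, chebPoint_eq_node,
      eval_T_real_node (Finset.mem_Iic.mpr (Nat.lt_succ_iff.mp k.2)), Polynomial.C_mul,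
      mul_assoc]
  have hder : (derivative^[m] (T ℝ n)).eval 1 = m.factorial * (taylor 1 (T ℝ n)).coeff m := by
    rw [taylor_coeff, ← factorial_smul_hasseDeriv, LinearMap.smul_apply, eval_smul, nsmul_eq_mul]
  rw [hder]
  conv_rhs => rw [hinterp]
  rw [map_sum, finsetSum_coeff, Finset.mul_sum]
  refine Finset.sum_congr rfl fun k _ => ?_
  rw [taylor_mul, taylor_C, coeff_C_mul,
    coeff_taylor_prod_X_sub_C hm (chebPoint n) 1 (fun j => Real.cos_le_one _), abs_lagrangeWeight_chebPoint]
  ring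

lemma tendsto_iterate_derivative_T_eval_one_div (m : ℕ) :
    Tendsto (fun n : ℕ => (derivative^[m] (T ℝ n)).eval 1 / (n : ℝ) ^ (2 * m)) atTop
      (𝓝 (1 / ∏ l ∈ Finset.range m, (2 * (l : ℝ) + 1))) := by
  have hfactor (l : ℕ) : Tendsto (fun n : ℕ => ((n : ℝ) ^ 2 - (l : ℝ) ^ 2) / (n : ℝ) ^ 2) atTop
      (𝓝 1) := by
    have h : Tendsto (fun n : ℕ => 1 - ((l : ℝ) / n) ^ 2) atTop (𝓝 (1 - 0 ^ 2)) :=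
      ((tendsto_const_div_atTop_nhds_zero_nat (l : ℝ)).pow 2).const_sub 1
    rw [zero_pow two_ne_zero, sub_zero] at h
    refine h.congr' ?_
    filter_upwards [eventually_ne_atTop 0] with n hn
    have : (n : ℝ) ≠ 0 := Nat.cast_ne_zero.mpr hn
    field_simp
  have hprod := (tendsto_finsetProd (Finset.range m) fun l _ => hfactor l).div_const
    (∏ l ∈ Finset.range m, (2 * (l : ℝ) + 1))
  rw [Finset.prod_const_one] at hprod
  refine hprod.congr fun n => ?_
  rw [iterate_derivative_T_eval_one_eq_div, Finset.prod_div_distrib, Finset.prod_const,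
    Finset.card_range, ← pow_mul]
  push_cast
  rw [div_right_comm]

/-! ### The series -/

/-- The constants `C_m = 1 / (m! (2m-1)!!)`. -/
noncomputable def edgeConst (m : ℕ) : ℝ :=
  1 / (∏ l ∈ Finset.range m, (2 * (l : ℝ) + 1)) / m.factorial

lemma edgeConst_one : edgeConst 1 = 1 := by
  norm_num [edgeConst]

lemma edgeConst_two : edgeConst 2 = 1 / 6 := by
  norm_num [edgeConst, Finset.prod_range_succ, Nat.factorial]

lemma edgeConst_three : edgeConst 3 = 1 / 90 := by
  norm_num [edgeConst, Finset.prod_range_succ, Nat.factorial]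

lemma edgeConst_four : edgeConst 4 = 1 / 2520 := by
  norm_num [edgeConst, Finset.prod_range_succ, Nat.factorial]

lemma bernoulli'_six : bernoulli' 6 = 1 / 42 := by
  rw [bernoulli'_def]
  have h5 : bernoulli' 5 = 0 := bernoulli'_eq_zero_of_odd (by decide) (by norm_num)
  norm_num [Finset.sum_range_succ, h5, Nat.choose]

lemma bernoulli'_eight : bernoulli' 8 = -1 / 30 := by
  rw [bernoulli'_def]
  have h5 : bernoulli' 5 = 0 := bernoulli'_eq_zero_of_odd (by decide) (by norm_num)
  have h7 : bernoulli' 7 = 0 := bernoulli'_eq_zero_of_odd (by decide) (by norm_num)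
  norm_num [Finset.sum_range_succ, h5, h7, bernoulli'_six, Nat.choose]

lemma hasSum_zeta_six : HasSum (fun n : ℕ => (1 : ℝ) / (n : ℝ) ^ 6) (Real.pi ^ 6 / 945) := by
  convert! hasSum_zeta_nat three_ne_zero using 1
  rw [bernoulli_eq_bernoulli'_of_ne_one (by decide), bernoulli'_six]
  norm_num [Nat.factorial]
  ring

lemma hasSum_zeta_eight : HasSum (fun n : ℕ => (1 : ℝ) / (n : ℝ) ^ 8) (Real.pi ^ 8 / 9450) := by
  convert! hasSum_zeta_nat four_ne_zero using 1
  rw [bernoulli_eq_bernoulli'_of_ne_one (by decide), bernoulli'_eight]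
  norm_num [Nat.factorial]
  ring

lemma hasSum_one_div_pi_mul_succ_pow {p : ℕ} (hp : p ≠ 0) {c : ℝ}
    (h : HasSum (fun n : ℕ => (1 : ℝ) / (n : ℝ) ^ p) (Real.pi ^ p * c)) :
    HasSum (fun k : ℕ => 1 / (Real.pi * (k + 1 : ℕ)) ^ p) c := by
  have h1 := ((hasSum_nat_add_iff' 1).mpr h).mul_left (1 / Real.pi ^ p)
  have hpi : Real.pi ^ p ≠ 0 := pow_ne_zero _ Real.pi_ne_zero
  convert! h1 using 1
  · funext k
    rw [mul_pow, one_div_mul_one_div]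
  -- The dropped `n = 0` term is `1 / 0 ^ p = 0`.
  · simp [hp]

/-- Used to fix the sign inside the absolute values. The cubic for `m = 4` is still negative at `9`,
so `π > 3` would not suffice. -/
lemma lt_pi_mul_succ_sq (k : ℕ) : 9.85 < (Real.pi * (k + 1 : ℕ)) ^ 2 := by
  have h1 : (1 : ℝ) ≤ (k + 1 : ℕ) := by exact_mod_cast Nat.succ_le_succ (Nat.zero_le k)
  have h2 : (3.14 : ℝ) ≤ Real.pi * (k + 1 : ℕ) := by nlinarith [Real.pi_gt_d2]
  nlinarith

lemma seriesTerm_three (k : ℕ) : seriesTerm 3 (k + 1) =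
    2 / 15 * (1 / (Real.pi * (k + 1 : ℕ)) ^ 2) - 8 / 3 * (1 / (Real.pi * (k + 1 : ℕ)) ^ 4) +
      16 * (1 / (Real.pi * (k + 1 : ℕ)) ^ 6) := by
  have hx := lt_pi_mul_succ_sq k
  have hk : ((k + 1 : ℕ) : ℝ) ≠ 0 := by positivity
  have hpi := Real.pi_ne_zero
  rw [seriesTerm, abs_of_pos]
  · field_simp
    ring
  · rw [mul_assoc 20, ← mul_pow, ← mul_pow]
    nlinarith [sq_nonneg ((Real.pi * (k + 1 : ℕ)) ^ 2 - 10)]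

lemma seriesTerm_four (k : ℕ) : seriesTerm 4 (k + 1) =
    2 / 315 * (1 / (Real.pi * (k + 1 : ℕ)) ^ 2) - 4 / 15 * (1 / (Real.pi * (k + 1 : ℕ)) ^ 4) +
      16 / 3 * (1 / (Real.pi * (k + 1 : ℕ)) ^ 6) - 32 * (1 / (Real.pi * (k + 1 : ℕ)) ^ 8) := by
  have hx := lt_pi_mul_succ_sq k
  have hk : ((k + 1 : ℕ) : ℝ) ≠ 0 := by positivity
  have hpi := Real.pi_ne_zero
  rw [seriesTerm, abs_of_pos]
  · field_simp
    ring
  · rw [mul_assoc 42, mul_assoc 840, ← mul_pow, ← mul_pow, ← mul_pow]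
    set y := (Real.pi * (k + 1 : ℕ)) ^ 2 with hy
    rw [show (Real.pi * (k + 1 : ℕ)) ^ 6 = y ^ 3 by rw [hy]; ring,
      show (Real.pi * (k + 1 : ℕ)) ^ 4 = y ^ 2 by rw [hy]; ring]
    -- Since `9.85 + 2 * 16.075 = 42`, subtracting this product cancels the cubic and quadratic
    -- terms; the linear remainder is positive for `y > 9.85`.
    nlinarith [mul_nonneg (sub_nonneg.mpr hx.le) (sq_nonneg (y - 16.075))]

lemma hasSum_seriesTerm {m : ℕ} (h1 : 1 ≤ m) (h4 : m ≤ 4) :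
    HasSum (fun k : ℕ => seriesTerm m (k + 1)) (edgeConst m - headTerm m) := by
  have z2 := hasSum_one_div_pi_mul_succ_pow two_ne_zero (c := 1 / 6)
    (by convert! hasSum_zeta_two using 1; ring)
  have z4 := hasSum_one_div_pi_mul_succ_pow four_ne_zero (c := 1 / 90)
    (by convert! hasSum_zeta_four using 1; ring)
  have z6 := hasSum_one_div_pi_mul_succ_pow (p := 6) (by norm_num) (c := 1 / 945)
    (by convert! hasSum_zeta_six using 1; ring)
  have z8 := hasSum_one_div_pi_mul_succ_pow (p := 8) (by norm_num) (c := 1 / 9450)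
    (by convert! hasSum_zeta_eight using 1; ring)
  interval_cases m
  · convert! z2.mul_left 4 using 1
    · funext k
      rw [seriesTerm, mul_pow]
      ring
    · norm_num [edgeConst_one, headTerm]
  · convert! (z2.mul_left (4 / 3)).sub (z4.mul_left 8) using 1
    · funext k
      rw [seriesTerm, mul_pow, mul_pow]
      have hk : ((k + 1 : ℕ) : ℝ) ≠ 0 := by positivity
      have hpi := Real.pi_ne_zero
      field_simp
      ring
    · norm_num [edgeConst_two, headTerm]
  · convert! ((z2.mul_left (2 / 15)).sub (z4.mul_left (8 / 3))).add (z6.mul_left 16) using 1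
    · exact funext seriesTerm_three
    · norm_num [edgeConst_three, headTerm]
  · convert! (((z2.mul_left (2 / 315)).sub (z4.mul_left (4 / 15))).add
      (z6.mul_left (16 / 3))).sub (z8.mul_left 32) using 1
    · exact funext seriesTerm_four
    · norm_num [edgeConst_four, headTerm]

/-! ### Asymptotics of the rounding bound -/

lemma isEquivalent_mul_pow_of_tendsto {a c : ℕ → ℝ} {L : ℝ} (hL : L ≠ 0) (p : ℕ)
    (ha : Tendsto (fun n : ℕ => a n / (n : ℝ) ^ p) atTop (𝓝 L))
    (hc : Tendsto c atTop (𝓝 L)) :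
    a ~[atTop] fun n : ℕ => c n * (n : ℝ) ^ p := by
  have h : (fun n : ℕ => a n / (n : ℝ) ^ p) ~[atTop] c :=
    ((isEquivalent_const_iff_tendsto hL).mpr ha).trans
      ((isEquivalent_const_iff_tendsto hL).mpr hc).symm
  refine (h.mul (IsEquivalent.refl (u := fun n : ℕ => (n : ℝ) ^ p))).congr_left ?_
  filter_upwards [eventually_ne_atTop 0] with n hn
  exact div_mul_cancel₀ _ (pow_ne_zero _ (Nat.cast_ne_zero.mpr hn))

/-- A varying `c` covers both the partial sums and the constant `C_m`. -/
lemma roundingBound_isEquivalent (m : ℕ) (u : ℕ → ℝ) (f : ℕ → ℝ → ℝ) {c : ℕ → ℝ}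
    (hc : Tendsto c atTop (𝓝 (edgeConst m))) :
    (fun n : ℕ => roundingBound (chebPoint n) 1 m (u n) (f n)) ~[atTop]
      (fun n : ℕ => gammaErr (u n) (6 * n + 4 - m) * maxAbs (chebPoint n) (f n) *
        ((m.factorial : ℝ) * (c n * (n : ℝ) ^ (2 * m)))) := by
  have hfac : (m.factorial : ℝ) ≠ 0 := Nat.cast_ne_zero.mpr m.factorial_ne_zero
  have hprod : ∏ l ∈ Finset.range m, (2 * (l : ℝ) + 1) ≠ 0 :=
    Finset.prod_ne_zero_iff.mpr fun l _ => by positivity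
  have hlim := hc.const_mul (m.factorial : ℝ)
  rw [edgeConst, mul_div_cancel₀ _ hfac] at hlim
  have h := isEquivalent_mul_pow_of_tendsto (one_div_ne_zero hprod) (2 * m)
    (tendsto_iterate_derivative_T_eval_one_div m) hlim
  simp only [mul_assoc (m.factorial : ℝ)] at h
  -- The factor `γ |f|` is common to both sides, so it may vary freely with `n`, or even vanish.
  refine ((IsEquivalent.refl (u := fun n : ℕ => gammaErr (u n) (6 * n + 4 - m) *
    maxAbs (chebPoint n) (f n))).mul h).congr_left ?_
  filter_upwards [eventually_ge_atTop m] with n hn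
  simp only [Pi.mul_apply, roundingBound, sum_weight_mul_esymm_eq n m hn]

end ChebRounding

open ChebRounding in
theorem theorem2 :
    ∃ C : ℕ → ℝ,
      (∀ m : ℕ, 1 ≤ m → m ≤ 4 →
        HasSum (fun k : ℕ => seriesTerm m (k + 1)) (C m - headTerm m) ∧
        ∀ (u : ℕ → ℝ) (f : ℕ → ℝ → ℝ),
          (∀ᶠ n : ℕ in atTop, 0 < u n ∧ ((6 * n + 4 - m : ℕ) : ℝ) * u n < 1) →
          (fun n : ℕ => roundingBound (chebPoint n) 1 m (u n) (f n)) ~[atTop]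
            (fun n : ℕ => gammaErr (u n) (6 * n + 4 - m) * maxAbs (chebPoint n) (f n) *
              ((m.factorial : ℝ) * (headTerm m * (n : ℝ) ^ (2 * m) +
                ∑ k ∈ Finset.Icc 1 n, seriesTerm m k * (n : ℝ) ^ (2 * m)))) ∧
          (fun n : ℕ => roundingBound (chebPoint n) 1 m (u n) (f n)) ~[atTop]
            (fun n : ℕ => gammaErr (u n) (6 * n + 4 - m) * maxAbs (chebPoint n) (f n) *
              ((m.factorial : ℝ) * (C m * (n : ℝ) ^ (2 * m))))) ∧
      C 1 = 1 ∧ C 2 = 1 / 6 ∧ C 3 = 1 / 90 ∧ C 4 = 1 / 2520 := by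
  refine ⟨edgeConst, fun m h1 h4 => ⟨hasSum_seriesTerm h1 h4, fun u f _ => ⟨?_, ?_⟩⟩,
    edgeConst_one, edgeConst_two, edgeConst_three, edgeConst_four⟩
  · have h := ((hasSum_seriesTerm h1 h4).tendsto_sum_nat).const_add (headTerm m)
    rw [add_sub_cancel] at h
    refine (roundingBound_isEquivalent m u f h).congr_right (Eventually.of_forall fun n => ?_)
    simp only [← Finset.sum_mul, ← add_mul]
    rw [Finset.range_eq_Ico, Finset.sum_Ico_add' (seriesTerm m) 0 n 1, zero_add]
    rfl
  · exact roundingBound_isEquivalent m u f tendsto_const_nhds
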